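/- For real dimensions $D,m>0$ and $p,q\ge 0$ consider the Feynman integral $$I_{D,m}(p,q)=\int\frac{d^mq'}{(2\pi)^m}\int\frac{d^Dp'}{(2\pi)^D}\,\frac{1}{|\boldsymbol p'|^2+|\boldsymbol q'|^4}\,\frac{1}{|\boldsymbol p'+\boldsymbol p|^2+|\boldsymbol q'+\boldsymbol q|^4},$$ where $\boldsymbol p\in\mathbb R^D$ and $\boldsymbol q\in\mathbb R^m$ are vectors of lengths $p$ and $q$. For a real dimension $\nu>0$, the integral of a function $f(x,y)$ of the component $x\in\mathbb R$ of $\boldsymbol k\in\mathbb R^\nu$ along a fixed axis and of the length $y\ge0$ of its component orthogonal to that axis is understood, for $\nu>1$, as $$\int d^\nu k\,f=\frac{2\pi^{(\nu-1)/2}}{\Gamma(\frac{\nu-1}{2})}\int_{-\infty}^{\infty}dx\int_0^\infty dy\,y^{\nu-2}f(x,y),$$ and by its analytic continuation $$\int d^\nu k\,f=-\frac{\pi^{(\nu-1)/2}}{\Gamma(\frac{\nu+1}{2})}\int_{-\infty}^{\infty}dx\int_0^\infty dy\,y^{\nu-1}\,\frac{\partial f}{\partial y}(x,y)$$ for all $\nu>0$;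 for integer $\nu$ it is the usual integral over $\mathbb R^\nu$. Fix $0<D<4$ and $p,q\ge0$, not both zero. Put $m=8-2D-2\epsilon'$, that is, $\epsilon'=4-D-\frac m2$. Then $$I_{D,m}(p,q)=\frac{8\,(16\pi)^{(D-7)/2}}{\epsilon'\,\Gamma\!\left(\frac52-\frac D2\right)}+O(1)\qquad(\epsilon'\to0+).$$ In particular the coefficient of the pole $1/\epsilon'$ does not depend on $p$ and $q$; the bound in $O(1)$ may depend on $D$, $p$ and $q$. -/

import Mathlib

open MeasureTheory Filter Topology Asymptotics

/-- The integral `∫ d^ν k f` over a space of real dimension `ν > 0`, for an integrand `f x y` that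
depends on `k` only through its component `x` along a fixed axis and the length `y ≥ 0` of its
component orthogonal to that axis. For `ν > 1` rotational symmetry gives
`∫ d^ν k f = 2 π ^ ((ν-1)/2) / Γ((ν-1)/2) * ∫ dx ∫₀^∞ dy y ^ (ν-2) f x y`.
One integration by parts in `y` puts this in the form below, which is the analytic continuation of
that formula to all `ν > 0`. The lemmas after the definition show the agreement with the
cylindrical-coordinates formula for `ν > 1`, and with the ordinary integral for integer `ν`. -/
noncomputable def dimIntegral (ν : ℝ) (f : ℝ → ℝ → ℝ) : ℝ :=
  -(Real.pi ^ ((ν - 1) / 2) / Real.Gamma ((ν + 1) / 2)) *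
    ∫ z in Set.univ ×ˢ Set.Ioi (0 : ℝ), z.2 ^ (ν - 1) * deriv (f z.1) z.2

/-- In dimension one the continued integral is the ordinary integral over the line. -/
theorem dimIntegral_one (f : ℝ → ℝ → ℝ)
    (hf : ∀ x, ∀ y > 0, DifferentiableAt ℝ (f x) y)
    (h0 : ∀ x, ContinuousWithinAt (f x) (Set.Ici 0) 0)
    (hi : ∀ x, Tendsto (f x) atTop (𝓝 0))
    (h1 : IntegrableOn (fun z : ℝ × ℝ => deriv (f z.1) z.2) (Set.univ ×ˢ Set.Ioi (0 : ℝ))) :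
    dimIntegral 1 f = ∫ x, f x 0 := by
  have e : ∀ᵐ x : ℝ, ∫ y in Set.Ioi (0 : ℝ), deriv (f x) y = -f x 0 := by
    have h2 : Integrable (fun z : ℝ × ℝ => deriv (f z.1) z.2)
        (volume.prod (volume.restrict (Set.Ioi (0 : ℝ)))) := by
      have := h1
      rwa [IntegrableOn, Measure.volume_eq_prod, ← Measure.prod_restrict,
        Measure.restrict_univ] at this
    filter_upwards [h2.prod_right_ae] with x hx
    rw [integral_Ioi_of_hasDerivAt_of_tendsto (h0 x) (fun y hy => (hf x y hy).hasDerivAt) hx (hi x),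
      zero_sub]
  have e2 : ∫ z in Set.univ ×ˢ Set.Ioi (0 : ℝ), deriv (f z.1) z.2 = -∫ x, f x 0 := by
    rw [Measure.volume_eq_prod, setIntegral_prod _ (by simpa [Measure.volume_eq_prod] using h1),
      Measure.restrict_univ, integral_congr_ae e, integral_neg]
  simp [dimIntegral, e2]

/-- For `ν > 1` the continued integral is the integral in cylindrical coordinates, `2 π ^ ((ν-1)/2) /
Γ((ν-1)/2)` being the area of the unit sphere of the `(ν-1)`-dimensional orthogonal complement. -/
theorem dimIntegral_of_one_lt {ν : ℝ} (hν : 1 < ν) (f : ℝ → ℝ → ℝ)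
    (hf : ∀ x, ∀ y > 0, DifferentiableAt ℝ (f x) y)
    (h0 : ∀ᵐ x, Tendsto (fun y => y ^ (ν - 1) * f x y) (𝓝[>] 0) (𝓝 0))
    (hi : ∀ᵐ x, Tendsto (fun y => y ^ (ν - 1) * f x y) atTop (𝓝 0))
    (h1 : IntegrableOn (fun z : ℝ × ℝ => z.2 ^ (ν - 1) * deriv (f z.1) z.2)
      (Set.univ ×ˢ Set.Ioi (0 : ℝ)))
    (h2 : IntegrableOn (fun z : ℝ × ℝ => z.2 ^ (ν - 2) * f z.1 z.2)
      (Set.univ ×ˢ Set.Ioi (0 : ℝ))) :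
    dimIntegral ν f = 2 * Real.pi ^ ((ν - 1) / 2) / Real.Gamma ((ν - 1) / 2) *
      ∫ z in Set.univ ×ˢ Set.Ioi (0 : ℝ), z.2 ^ (ν - 2) * f z.1 z.2 := by
  have k : ∀ g : ℝ × ℝ → ℝ, IntegrableOn g (Set.univ ×ˢ Set.Ioi (0 : ℝ)) →
      Integrable g (volume.prod (volume.restrict (Set.Ioi (0 : ℝ)))) := by
    intro g hg
    rwa [IntegrableOn, Measure.volume_eq_prod, ← Measure.prod_restrict,
        Measure.restrict_univ] at hg
  have e : ∀ᵐ x : ℝ, ∫ y in Set.Ioi (0 : ℝ), y ^ (ν - 1) * deriv (f x) y =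
      -((ν - 1) * ∫ y in Set.Ioi (0 : ℝ), y ^ (ν - 2) * f x y) := by
    filter_upwards [(k _ h1).prod_right_ae, (k _ h2).prod_right_ae, h0, hi] with x a1 a2 a3 a4
    have hd : ∀ y ∈ Set.Ioi (0 : ℝ),
        HasDerivAt (fun y : ℝ => y ^ (ν - 1)) ((ν - 1) * y ^ (ν - 2)) y := by
      intro y hy
      have := Real.hasDerivAt_rpow_const (x := y) (p := ν - 1) (Or.inl (ne_of_gt hy))
      rwa [show ν - 1 - 1 = ν - 2 by ring] at this
    rw [integral_Ioi_mul_deriv_eq_deriv_mul hd (fun y hy => (hf x y hy).hasDerivAt) a1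
      (by simpa [Pi.mul_def, mul_assoc, IntegrableOn] using a2.const_mul (ν - 1)) a3 a4]
    simp [mul_assoc, integral_const_mul]
  rw [dimIntegral, Measure.volume_eq_prod, setIntegral_prod _ h1, setIntegral_prod _ h2,
    Measure.restrict_univ, integral_congr_ae e, integral_neg, integral_const_mul]
  have hG : Real.Gamma ((ν + 1) / 2) = (ν - 1) / 2 * Real.Gamma ((ν - 1) / 2) := by
    rw [← Real.Gamma_add_one (by linarith)]; congr 1; ring
  have := (Real.Gamma_pos_of_pos (show 0 < (ν - 1) / 2 by linarith)).ne'
  have h3 : ν - 1 ≠ 0 := by linarith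
  rw [hG]; field_simp

/-- In every integer dimension `n + 2 ≥ 2` the continued integral is the ordinary integral over
`ℝ × ℝ ^ (n + 1)`. -/
theorem dimIntegral_natCast_add_two (n : ℕ) (f : ℝ → ℝ → ℝ)
    (hf : ∀ x, ∀ y > 0, DifferentiableAt ℝ (f x) y)
    (h0 : ∀ᵐ x, Tendsto (fun y => y ^ ((n + 2 : ℝ) - 1) * f x y) (𝓝[>] 0) (𝓝 0))
    (hi : ∀ᵐ x, Tendsto (fun y => y ^ ((n + 2 : ℝ) - 1) * f x y) atTop (𝓝 0))
    (h1 : IntegrableOn (fun z : ℝ × ℝ => z.2 ^ ((n + 2 : ℝ) - 1) * deriv (f z.1) z.2)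
      (Set.univ ×ˢ Set.Ioi (0 : ℝ)))
    (h2 : IntegrableOn (fun z : ℝ × ℝ => z.2 ^ ((n + 2 : ℝ) - 2) * f z.1 z.2)
      (Set.univ ×ˢ Set.Ioi (0 : ℝ)))
    (h : Integrable (fun z : ℝ × EuclideanSpace ℝ (Fin (n + 1)) => f z.1 ‖z.2‖)) :
    dimIntegral (n + 2) f = ∫ z : ℝ × EuclideanSpace ℝ (Fin (n + 1)), f z.1 ‖z.2‖ := by
  rw [dimIntegral_of_one_lt (by linarith [n.cast_nonneg (α := ℝ)]) f hf h0 hi h1 h2]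
  symm
  rw [Measure.volume_eq_prod] at h ⊢
  rw [integral_prod _ h, Measure.volume_eq_prod, setIntegral_prod _ h2, Measure.restrict_univ,
    ← integral_const_mul]
  congr 1; ext x
  rw [integral_fun_norm_addHaar volume (f x)]
  have e : ∀ y : ℝ, y ^ ((n : ℝ) + 2 - 2) = y ^ n := by
    intro y; rw [← Real.rpow_natCast]; congr 1; ring
  simp only [e, smul_eq_mul, finrank_euclideanSpace_fin, Measure.real, EuclideanSpace.volume_ball,
    Fintype.card_fin, Nat.add_sub_cancel, nsmul_eq_mul]
  rw [← mul_assoc]; congr 1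
  have hp : 0 < Real.Gamma ((n + 1 : ℝ) / 2) := Real.Gamma_pos_of_pos (by positivity)
  have hG : Real.Gamma (((n + 1 : ℕ) : ℝ) / 2 + 1) = (n + 1) / 2 * Real.Gamma ((n + 1) / 2) := by
    rw [Real.Gamma_add_one (by positivity)]; push_cast; ring
  rw [hG, ENNReal.ofReal_one, one_pow, one_mul, ENNReal.toReal_ofReal (by positivity),
    show (n : ℝ) + 2 - 1 = n + 1 by ring, Real.sqrt_eq_rpow, ← Real.rpow_mul_natCast Real.pi_pos.le]
  push_cast
  rw [show (1 / 2 : ℝ) * (n + 1) = (n + 1) / 2 by ring]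
  field_simp

/-- The inner integral
`∫ d^D p' / (2π)^D * 1 / (|p'|² + M₁²) * 1 / (|p' + p|² + M₂²)`,
where `p ≥ 0` is the length of the external vector and the axis is taken along that vector. -/
noncomputable def innerIntegral (D p M₁ M₂ : ℝ) : ℝ :=
  ((2 * Real.pi) ^ D)⁻¹ * dimIntegral D (fun x y =>
    1 / ((x ^ 2 + y ^ 2) + M₁ ^ 2) * (1 / (((x + p) ^ 2 + y ^ 2) + M₂ ^ 2)))

/-- The Feynman integral
`I_{D,m}(p,q) = ∫ d^m q' / (2π)^m ∫ d^D p' / (2π)^D 1 / (|p'|² + |q'|⁴) * 1 / (|p' + p|² + |q' + q|⁴)`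
in real dimensions `D, m > 0`, as a function of the lengths `p, q ≥ 0` of the external vectors:
here `|q'|² = x² + y²` and `|q' + q|² = (x + q)² + y²`. -/
noncomputable def feynmanIntegral (D m p q : ℝ) : ℝ :=
  ((2 * Real.pi) ^ m)⁻¹ * dimIntegral m (fun x y =>
    innerIntegral D p (x ^ 2 + y ^ 2) ((x + q) ^ 2 + y ^ 2))

/-! The divergence is ultraviolet: it comes from large outer momentum, where `p` and `q` act only as
a mass. Feynman parametrization turns the inner loop into `loopConst D` times `∫ M ^ (-(2 - D/2))
dt` over `0 < t < 1`, with `M = feynmanMass` (`innerIntegral_eq_integral`). The `y`-derivative in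
the continued outer integral then leaves the integrand `y ^ m * M ^ (-(3 - D/2)) * W`, with `W =
mixedSq` (`feynmanIntegral_eq_integral`).

`M` is quartic in the outer variables, but it is comparable to `u²` for the quadratic `u = (x + t
q)² + y² + comparisonGap p q t`. Replacing the integrand by `y ^ m * u ^ (-(5 - D))` costs an error
of order `√(t(1-t)) * y ^ m * u ^ (-(6 - D))` (`abs_feynmanMass_rpow_sub_le`). Powers of `u`
integrate exactly (`integral_radial`). With `m/2 = 4 - D - ε` the main term is a multiple of `Γ(ε) ∫
gap ^ (-ε) dt`, while the error carries only `Γ(ε + 1)` and stays bounded.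

Since the gap is at least `√(t(1-t)) (p + q²)`, its inverse is integrable in `t`, so `∫ gap ^ (-ε)
dt = 1 + O(ε)`. Hence `p` and `q` drop out of the pole. The duplication formula for `Γ` gives the
residue its stated form. -/

/-! ### Radial integrals over the half plane -/

/-- Lebesgue measure on the half plane of the pairs `(x, y)` with `y > 0`. -/
noncomputable abbrev halfPlane : Measure (ℝ × ℝ) :=
  (volume : Measure ℝ).prod (volume.restrict (Set.Ioi (0 : ℝ)))

theorem volume_restrict_univ_prod_Ioi :
    (volume : Measure (ℝ × ℝ)).restrict (Set.univ ×ˢ Set.Ioi (0 : ℝ)) = halfPlane := by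
  rw [Measure.volume_eq_prod, ← Measure.prod_restrict, Measure.restrict_univ]

theorem ae_halfPlane {P : ℝ × ℝ → Prop} (h : ∀ x, ∀ y > 0, P (x, y)) :
    ∀ᵐ z ∂halfPlane, P z := by
  rw [← volume_restrict_univ_prod_Ioi,
    ae_restrict_iff' (MeasurableSet.univ.prod measurableSet_Ioi)]
  exact Eventually.of_forall fun z hz => h z.1 z.2 hz.2

/-- A non-integrable function has Bochner integral `0` by default, so a nonzero value certifies
integrability. -/
theorem lintegral_ofReal_eq_of_integral_eq {α : Type*} [MeasurableSpace α] {μ : Measure α}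
    {f : α → ℝ} {c : ℝ} (hf : 0 ≤ᵐ[μ] f) (h : ∫ x, f x ∂μ = c) (hc : c ≠ 0) :
    ∫⁻ x, ENNReal.ofReal (f x) ∂μ = ENNReal.ofReal c := by
  rw [← ofReal_integral_eq_lintegral_ofReal (Integrable.of_integral_ne_zero (h ▸ hc)) hf, h]

theorem lintegral_gamma {s Q : ℝ} (hs : 0 < s) (hQ : 0 < Q) :
    ∫⁻ l in Set.Ioi (0 : ℝ), ENNReal.ofReal (l ^ (s - 1) * Real.exp (-(Q * l))) =
      ENNReal.ofReal (Q ^ (-s) * Real.Gamma s) := by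
  refine lintegral_ofReal_eq_of_integral_eq ?_ ?_ ?_
  · filter_upwards [ae_restrict_mem measurableSet_Ioi] with l hl
    have : (0 : ℝ) < l := hl
    positivity
  · rw [Real.integral_rpow_mul_exp_neg_mul_Ioi hs hQ, one_div, Real.inv_rpow hQ.le,
      Real.rpow_neg hQ.le]
  · have := Real.Gamma_pos_of_pos hs
    positivity

theorem lintegral_gaussian_add {l : ℝ} (hl : 0 < l) (h : ℝ) :
    ∫⁻ x : ℝ, ENNReal.ofReal (Real.exp (-l * (x + h) ^ 2)) =
      ENNReal.ofReal (√(Real.pi / l)) := by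
  rw [lintegral_add_right_eq_self (fun x : ℝ => ENNReal.ofReal (Real.exp (-l * x ^ 2))) h]
  refine lintegral_ofReal_eq_of_integral_eq (Eventually.of_forall fun x => by positivity)
    (integral_gaussian l) ?_
  have := Real.pi_pos
  positivity

theorem lintegral_rpow_mul_gaussian {l ν : ℝ} (hl : 0 < l) (hν : -1 < ν) :
    ∫⁻ y in Set.Ioi (0 : ℝ), ENNReal.ofReal (y ^ ν * Real.exp (-l * y ^ 2)) =
      ENNReal.ofReal (l ^ (-(ν + 1) / 2) * (1 / 2) * Real.Gamma ((ν + 1) / 2)) := by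
  have h := integral_rpow_mul_exp_neg_mul_rpow (p := 2) two_pos hν hl
  simp only [Real.rpow_two] at h
  refine lintegral_ofReal_eq_of_integral_eq ?_ h ?_
  · filter_upwards [ae_restrict_mem measurableSet_Ioi] with y hy
    have : (0 : ℝ) < y := hy
    positivity
  · have := Real.Gamma_pos_of_pos (show 0 < (ν + 1) / 2 by linarith)
    positivity

/-- The value of `∫ dx ∫₀^∞ dy y ^ ν ((x + h)² + y² + d) ^ (-s)`, without the power of `d`. -/
noncomputable def radialConst (ν s : ℝ) : ℝ :=
  √Real.pi / 2 * Real.Gamma ((ν + 1) / 2) * Real.Gamma (s - 1 - ν / 2) / Real.Gamma s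

theorem radialConst_pos {ν s : ℝ} (hν : -1 < ν) (hs : 1 + ν / 2 < s) : 0 < radialConst ν s := by
  have := Real.Gamma_pos_of_pos (show 0 < (ν + 1) / 2 by linarith)
  have := Real.Gamma_pos_of_pos (show 0 < s - 1 - ν / 2 by linarith)
  have := Real.Gamma_pos_of_pos (show 0 < s by linarith)
  have := Real.pi_pos
  unfold radialConst
  positivity

/-- Schwinger's trick: `Γ(s) Q ^ (-s) = ∫ l ^ (s-1) exp(-Q l) dl` makes the integrand a product of
Gaussians in `x` and `y`, and a last Gamma integral in `l` remains. With lower integrals the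
exchange is Tonelli and needs no integrability. -/
theorem lintegral_radial {ν s d : ℝ} (hν : -1 < ν) (hs : 1 + ν / 2 < s) (hd : 0 < d) (h : ℝ) :
    ∫⁻ z, ENNReal.ofReal (z.2 ^ ν * ((z.1 + h) ^ 2 + z.2 ^ 2 + d) ^ (-s)) ∂halfPlane =
      ENNReal.ofReal (radialConst ν s * d ^ (1 + ν / 2 - s)) := by
  have hs0 : 0 < s := by linarith
  have hG := Real.Gamma_pos_of_pos hs0
  have hG1 := Real.Gamma_pos_of_pos (show 0 < (ν + 1) / 2 by linarith)
  have key : ENNReal.ofReal (Real.Gamma s) *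
      ∫⁻ z, ENNReal.ofReal (z.2 ^ ν * ((z.1 + h) ^ 2 + z.2 ^ 2 + d) ^ (-s)) ∂halfPlane =
      ENNReal.ofReal (Real.Gamma s * (radialConst ν s * d ^ (1 + ν / 2 - s))) := by
    rw [← lintegral_const_mul' _ _ ENNReal.ofReal_ne_top]
    have e1 : ∀ᵐ z ∂halfPlane, ENNReal.ofReal (Real.Gamma s) *
        ENNReal.ofReal (z.2 ^ ν * ((z.1 + h) ^ 2 + z.2 ^ 2 + d) ^ (-s)) =
        ∫⁻ l in Set.Ioi (0 : ℝ), ENNReal.ofReal (l ^ (s - 1) * Real.exp (-(d * l))) *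
          (ENNReal.ofReal (Real.exp (-l * (z.1 + h) ^ 2)) *
            ENNReal.ofReal (z.2 ^ ν * Real.exp (-l * z.2 ^ 2))) := by
      refine ae_halfPlane fun x y hy => ?_
      have hyν : 0 ≤ y ^ ν := by positivity
      rw [mul_comm (y ^ ν), ← ENNReal.ofReal_mul hG.le, ← mul_assoc,
        mul_comm (Real.Gamma s), ENNReal.ofReal_mul' hyν, ← lintegral_gamma hs0 (by positivity),
        ← lintegral_mul_const' _ _ ENNReal.ofReal_ne_top]
      refine setLIntegral_congr_fun measurableSet_Ioi fun l hl => ?_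
      have : (0 : ℝ) < l := hl
      simp only
      rw [← ENNReal.ofReal_mul (by positivity), ← ENNReal.ofReal_mul (by positivity),
        ← ENNReal.ofReal_mul (by positivity)]
      congr 1
      rw [show -(((x + h) ^ 2 + y ^ 2 + d) * l) = -(d * l) + (-l * (x + h) ^ 2 + -l * y ^ 2) by
        ring, Real.exp_add, Real.exp_add]
      ring
    rw [lintegral_congr_ae e1, lintegral_lintegral_swap (by fun_prop)]
    have e2 : ∀ l ∈ Set.Ioi (0 : ℝ),
        ∫⁻ z, ENNReal.ofReal (l ^ (s - 1) * Real.exp (-(d * l))) *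
          (ENNReal.ofReal (Real.exp (-l * (z.1 + h) ^ 2)) *
            ENNReal.ofReal (z.2 ^ ν * Real.exp (-l * z.2 ^ 2))) ∂halfPlane =
        ENNReal.ofReal (√Real.pi * (1 / 2) * Real.Gamma ((ν + 1) / 2)) *
          ENNReal.ofReal (l ^ (s - 1 - ν / 2 - 1) * Real.exp (-(d * l))) := by
      intro l hl
      have hl : (0 : ℝ) < l := hl
      rw [lintegral_const_mul' _ _ ENNReal.ofReal_ne_top,
        lintegral_prod_mul (f := fun x : ℝ => ENNReal.ofReal (Real.exp (-l * (x + h) ^ 2)))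
          (g := fun y : ℝ => ENNReal.ofReal (y ^ ν * Real.exp (-l * y ^ 2)))
          (by fun_prop) (by fun_prop),
        lintegral_gaussian_add hl, lintegral_rpow_mul_gaussian hl hν,
        ← ENNReal.ofReal_mul (by positivity), ← ENNReal.ofReal_mul (by positivity),
        ← ENNReal.ofReal_mul (by positivity)]
      congr 1
      have : l ^ (s - 1 - ν / 2 - 1) = l ^ (s - 1) * (l ^ (-(1 / 2) : ℝ) * l ^ (-(ν + 1) / 2)) := by
        rw [← Real.rpow_add hl, ← Real.rpow_add hl]; congr 1; ring
      rw [this, Real.sqrt_div Real.pi_pos.le, Real.sqrt_eq_rpow l, Real.rpow_neg hl.le]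
      ring
    rw [setLIntegral_congr_fun measurableSet_Ioi e2,
      lintegral_const_mul' _ _ ENNReal.ofReal_ne_top, lintegral_gamma (by linarith) hd,
      ← ENNReal.ofReal_mul (by positivity)]
    congr 1
    rw [radialConst, show 1 + ν / 2 - s = -(s - 1 - ν / 2) by ring]
    field_simp
  rw [ENNReal.ofReal_mul hG.le] at key
  exact (ENNReal.mul_right_inj (by simpa using hG) ENNReal.ofReal_ne_top).1 key

theorem measurable_radial (ν s d h : ℝ) :
    Measurable fun z : ℝ × ℝ => z.2 ^ ν * ((z.1 + h) ^ 2 + z.2 ^ 2 + d) ^ (-s) := by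
  fun_prop

theorem radial_nonneg {ν s d h : ℝ} (hd : 0 < d) :
    ∀ᵐ z ∂halfPlane, 0 ≤ z.2 ^ ν * ((z.1 + h) ^ 2 + z.2 ^ 2 + d) ^ (-s) :=
  ae_halfPlane fun x y hy => by positivity

theorem integral_radial {ν s d : ℝ} (hν : -1 < ν) (hs : 1 + ν / 2 < s) (hd : 0 < d) (h : ℝ) :
    ∫ z, z.2 ^ ν * ((z.1 + h) ^ 2 + z.2 ^ 2 + d) ^ (-s) ∂halfPlane =
      radialConst ν s * d ^ (1 + ν / 2 - s) := by
  rw [integral_eq_lintegral_of_nonneg_ae (radial_nonneg hd)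
    (measurable_radial ν s d h).aestronglyMeasurable, lintegral_radial hν hs hd h,
    ENNReal.toReal_ofReal]
  have := radialConst_pos hν hs
  positivity

theorem integrable_radial {ν s d : ℝ} (hν : -1 < ν) (hs : 1 + ν / 2 < s) (hd : 0 < d) (h : ℝ) :
    Integrable (fun z : ℝ × ℝ => z.2 ^ ν * ((z.1 + h) ^ 2 + z.2 ^ 2 + d) ^ (-s)) halfPlane := by
  -- The value just computed is nonzero, which excludes the default value of a divergent integral.
  refine Integrable.of_integral_ne_zero ?_
  rw [integral_radial hν hs hd h]
  have := radialConst_pos hν hs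
  positivity

/-! ### Radial integrals depending on a Feynman parameter -/

/-- Lebesgue measure on the unit interval, in which the Feynman parameter varies. -/
noncomputable abbrev unitMeasure : Measure ℝ := volume.restrict (Set.Ioo (0 : ℝ) 1)

theorem ae_unitMeasure {P : ℝ → Prop} (h : ∀ t, 0 < t → t < 1 → P t) : ∀ᵐ t ∂unitMeasure, P t := by
  filter_upwards [ae_restrict_mem measurableSet_Ioo] with t ht using h t ht.1 ht.2

section Parameter

variable {ν s : ℝ} (hν : -1 < ν) (hs : 1 + ν / 2 < s) {w h d : ℝ → ℝ}
  (hw : Measurable w) (hw0 : ∀ t, 0 < t → t < 1 → 0 ≤ w t) (hh : Measurable h)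
  (hd : Measurable d) (hd0 : ∀ t, 0 < t → t < 1 → 0 < d t)
  (hi : Integrable (fun t => w t * d t ^ (1 + ν / 2 - s)) unitMeasure)

include hν hs hw hw0 hh hd hd0 hi

theorem integrable_radial_param :
    Integrable (fun a : ℝ × (ℝ × ℝ) =>
      w a.1 * (a.2.2 ^ ν * ((a.2.1 + h a.1) ^ 2 + a.2.2 ^ 2 + d a.1) ^ (-s)))
      (unitMeasure.prod halfPlane) := by
  rw [integrable_prod_iff (by fun_prop)]
  constructor
  · exact ae_unitMeasure fun t h0 h1 =>
      (integrable_radial hν hs (hd0 t h0 h1) (h t)).const_mul (w t)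
  · refine (hi.const_mul (radialConst ν s)).congr (ae_unitMeasure fun t h0 h1 => ?_)
    have e : ∀ᵐ z ∂halfPlane, ‖w t * (z.2 ^ ν * ((z.1 + h t) ^ 2 + z.2 ^ 2 + d t) ^ (-s))‖ =
        w t * (z.2 ^ ν * ((z.1 + h t) ^ 2 + z.2 ^ 2 + d t) ^ (-s)) := by
      filter_upwards [radial_nonneg (ν := ν) (s := s) (h := h t) (hd0 t h0 h1)] with z hz
      exact Real.norm_of_nonneg (mul_nonneg (hw0 t h0 h1) hz)
    simp only
    rw [integral_congr_ae e, integral_const_mul, integral_radial hν hs (hd0 t h0 h1)]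
    ring

theorem integral_radial_param :
    ∫ a, w a.1 * (a.2.2 ^ ν * ((a.2.1 + h a.1) ^ 2 + a.2.2 ^ 2 + d a.1) ^ (-s))
      ∂(unitMeasure.prod halfPlane) =
      radialConst ν s * ∫ t, w t * d t ^ (1 + ν / 2 - s) ∂unitMeasure := by
  rw [integral_prod _ (integrable_radial_param hν hs hw hw0 hh hd hd0 hi), ← integral_const_mul]
  refine integral_congr_ae (ae_unitMeasure fun t h0 h1 => ?_)
  simp only
  rw [integral_const_mul, integral_radial hν hs (hd0 t h0 h1)]
  ring

end Parameter

/-! ### The inner loop -/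

/-- This is Feynman's formula `1/(AB) = ∫ ((1-t)A + tB) ^ (-2) dt` after one `y`-derivative when `A'
= B' = 2y`, with the common factor `-2y` removed. -/
theorem integral_feynman_param {A B : ℝ} (hA : 0 < A) (hB : 0 < B) :
    ∫ t, 2 * ((1 - t) * A + t * B) ^ (-(3 : ℝ)) ∂unitMeasure = (A + B) / (A ^ 2 * B ^ 2) := by
  have hu : ∀ t ∈ Set.Icc (0 : ℝ) 1, 0 < (1 - t) * A + t * B := by
    rintro t ⟨h0, h1⟩
    rcases h0.eq_or_lt with rfl | h0
    · simpa using hA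
    · have := mul_nonneg (sub_nonneg.2 h1) hA.le
      positivity
  have hI : Set.uIcc (0 : ℝ) 1 = Set.Icc 0 1 := Set.uIcc_of_le zero_le_one
  have h := intervalIntegral.integral_eq_sub_of_hasDerivAt (a := 0) (b := 1)
    -- This is `(A⁻² - v⁻²)/(B - A)` for `v = (1-t)A + tB`, with `B - A` cancelled so that `A = B`
    -- needs no separate case.
    (f := fun t : ℝ => t * (((1 - t) * A + t * B) + A) / (A ^ 2 * ((1 - t) * A + t * B) ^ 2))
    (f' := fun t => 2 * ((1 - t) * A + t * B) ^ (-(3 : ℝ))) ?_ ?_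
  · rw [← integral_Ioc_eq_integral_Ioo, ← intervalIntegral.integral_of_le zero_le_one, h]
    field_simp
    ring
  · intro t ht
    have hu := hu t (hI ▸ ht)
    have h1 : HasDerivAt (fun t : ℝ => (1 - t) * A + t * B) (B - A) t := by
      have := (((hasDerivAt_id t).const_sub 1).mul_const A).add ((hasDerivAt_id t).mul_const B)
      exact this.congr_deriv (by ring)
    have h2 := ((hasDerivAt_id t).mul (h1.add_const A)).div ((h1.pow 2).const_mul (A ^ 2))
      (by simp only [Pi.pow_apply]; positivity)
    refine h2.congr_deriv ?_
    rw [show (-(3 : ℝ)) = ((-3 : ℤ) : ℝ) by norm_num, Real.rpow_intCast, zpow_neg]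
    simp only [id, Pi.mul_apply, Pi.pow_apply]
    field_simp
    ring
  · refine ContinuousOn.intervalIntegrable ?_
    rw [hI]
    refine ContinuousOn.mul continuousOn_const ?_
    exact ContinuousOn.rpow_const (by fun_prop) fun t ht => Or.inl (hu t ht).ne'

/-- The constant of the one-loop integral `∫ d^D k / (2π)^D (k² + 1) ^ (-2)`. -/
noncomputable def loopConst (D : ℝ) : ℝ :=
  (4 * Real.pi) ^ (-(D / 2)) * Real.Gamma (2 - D / 2)

/-- Completing the square in `x` shifts it by `t p` and leaves the bracket as mass term. After the
`y`-derivative the weight is `y ^ D` and the exponent `3`, so convergence is exactly `D < 4`. -/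
theorem innerIntegral_eq_integral {D M₁ M₂ : ℝ} (hD0 : 0 < D) (hD4 : D < 4) (p : ℝ) (h₁ : 0 < M₁)
    (h₂ : 0 < M₂) :
    innerIntegral D p M₁ M₂ = loopConst D *
      ∫ t, (t * (1 - t) * p ^ 2 + (1 - t) * M₁ ^ 2 + t * M₂ ^ 2) ^ (-(2 - D / 2)) ∂unitMeasure := by
  have hd0 : ∀ t : ℝ, 0 < t → t < 1 → min (M₁ ^ 2) (M₂ ^ 2) ≤
      t * (1 - t) * p ^ 2 + (1 - t) * M₁ ^ 2 + t * M₂ ^ 2 := by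
    intro t h0 h1
    have h1 := sub_pos.2 h1
    nlinarith [min_le_left (M₁ ^ 2) (M₂ ^ 2), min_le_right (M₁ ^ 2) (M₂ ^ 2),
      mul_nonneg (mul_pos h0 h1).le (sq_nonneg p)]
  have hm : 0 < min (M₁ ^ 2) (M₂ ^ 2) := by positivity
  -- The weight `4` is the `2` of the factor `2y` from the derivative times the `2` in
  -- `integral_feynman_param`.
  have hi : Integrable (fun t : ℝ => 4 *
      (t * (1 - t) * p ^ 2 + (1 - t) * M₁ ^ 2 + t * M₂ ^ 2) ^ (1 + D / 2 - 3)) unitMeasure := by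
    refine Integrable.mono' (integrable_const (4 * min (M₁ ^ 2) (M₂ ^ 2) ^ (1 + D / 2 - 3)))
      (Measurable.aestronglyMeasurable (by fun_prop)) (ae_unitMeasure fun t h0 h1 => ?_)
    have := hd0 t h0 h1
    rw [Real.norm_of_nonneg (by positivity)]
    have := Real.rpow_le_rpow_of_nonpos hm this (show 1 + D / 2 - 3 ≤ 0 by linarith)
    linarith
  have hν : -1 < D := by linarith
  have hs : 1 + D / 2 < 3 := by linarith
  have hint := integrable_radial_param (w := fun _ => 4) (h := fun t => t * p) hν hs
    (by fun_prop) (fun t _ _ => by norm_num) (by fun_prop) (by fun_prop)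
    (fun t h0 h1 => hm.trans_le (hd0 t h0 h1)) hi
  have hval := integral_radial_param (w := fun _ => 4) (h := fun t => t * p) hν hs
    (by fun_prop) (fun t _ _ => by norm_num) (by fun_prop) (by fun_prop)
    (fun t h0 h1 => hm.trans_le (hd0 t h0 h1)) hi
  rw [integral_prod_symm _ hint] at hval
  have e : ∀ᵐ z ∂halfPlane, z.2 ^ (D - 1) * deriv (fun y =>
      1 / ((z.1 ^ 2 + y ^ 2) + M₁ ^ 2) * (1 / (((z.1 + p) ^ 2 + y ^ 2) + M₂ ^ 2))) z.2 =
      -∫ t, 4 * (z.2 ^ D * ((z.1 + t * p) ^ 2 + z.2 ^ 2 +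
        (t * (1 - t) * p ^ 2 + (1 - t) * M₁ ^ 2 + t * M₂ ^ 2)) ^ (-(3 : ℝ))) ∂unitMeasure := by
    refine ae_halfPlane fun x y hy => ?_
    have hA : 0 < x ^ 2 + y ^ 2 + M₁ ^ 2 := by positivity
    have hB : 0 < (x + p) ^ 2 + y ^ 2 + M₂ ^ 2 := by positivity
    have h1 : HasDerivAt (fun y : ℝ => x ^ 2 + y ^ 2 + M₁ ^ 2) (2 * y) y := by
      simpa using ((hasDerivAt_pow 2 y).const_add (x ^ 2)).add_const (M₁ ^ 2)
    have h2 : HasDerivAt (fun y : ℝ => (x + p) ^ 2 + y ^ 2 + M₂ ^ 2) (2 * y) y := by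
      simpa using ((hasDerivAt_pow 2 y).const_add ((x + p) ^ 2)).add_const (M₂ ^ 2)
    have h3 := ((h1.inv hA.ne').mul (h2.inv hB.ne')).deriv
    simp only [one_div]
    erw [h3]
    have hy' : y ^ D = y ^ (D - 1) * y := by
      rw [Real.rpow_sub_one hy.ne']; field_simp
    have e2 : ∀ t : ℝ, 4 * (y ^ D * ((x + t * p) ^ 2 + y ^ 2 +
        (t * (1 - t) * p ^ 2 + (1 - t) * M₁ ^ 2 + t * M₂ ^ 2)) ^ (-(3 : ℝ))) =
        2 * y ^ D * (2 * ((1 - t) * (x ^ 2 + y ^ 2 + M₁ ^ 2) +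
          t * ((x + p) ^ 2 + y ^ 2 + M₂ ^ 2)) ^ (-(3 : ℝ))) := by
      intro t
      rw [show (x + t * p) ^ 2 + y ^ 2 + (t * (1 - t) * p ^ 2 + (1 - t) * M₁ ^ 2 + t * M₂ ^ 2) =
        (1 - t) * (x ^ 2 + y ^ 2 + M₁ ^ 2) + t * ((x + p) ^ 2 + y ^ 2 + M₂ ^ 2) by ring]
      ring
    simp only [e2]
    rw [integral_const_mul, integral_feynman_param hA hB, hy']
    simp only [Pi.inv_apply]
    field_simp
    ring
  rw [innerIntegral, dimIntegral, volume_restrict_univ_prod_Ioi, integral_congr_ae e,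
    integral_neg, hval, integral_const_mul, radialConst, loopConst,
    show (3 : ℝ) - 1 - D / 2 = 2 - D / 2 by ring, show 1 + D / 2 - 3 = -(2 - D / 2) by ring,
    Real.Gamma_ofNat_eq_factorial, Real.rpow_neg (by positivity)]
  have hG := Real.Gamma_pos_of_pos (show 0 < (D + 1) / 2 by linarith)
  have hp1 : (4 * Real.pi) ^ (D / 2) = 2 ^ D * Real.pi ^ (D / 2) := by
    rw [Real.mul_rpow (by norm_num) Real.pi_pos.le, show (4 : ℝ) = 2 ^ (2 : ℝ) by norm_num,
      ← Real.rpow_mul (by norm_num)]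
    congr 2; ring
  have hp2 : (2 * Real.pi) ^ D = 2 ^ D * (Real.pi ^ (D / 2) * Real.pi ^ (D / 2)) := by
    rw [Real.mul_rpow (by norm_num) Real.pi_pos.le, ← Real.rpow_add Real.pi_pos]
    congr 2; ring
  have hp3 : Real.pi ^ ((D - 1) / 2) * √Real.pi = Real.pi ^ (D / 2) := by
    rw [Real.sqrt_eq_rpow, ← Real.rpow_add Real.pi_pos]
    congr 1; ring
  rw [hp1, hp2, ← hp3]
  have := Real.pi_pos
  generalize ∫ t, (t * (1 - t) * p ^ 2 + (1 - t) * M₁ ^ 2 + t * M₂ ^ 2) ^ (-(2 - D / 2))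
    ∂unitMeasure = J
  norm_num [Nat.factorial]
  field_simp
  ring

/-! ### The Feynman mass and its derivative -/

/-- The convex combination of `|k|²` and `|k + q|²` with weights `1 - t` and `t`, where `k` has the
components `x` along `q` and `y` orthogonal to it. -/
def mixedSq (q x y t : ℝ) : ℝ := (x + t * q) ^ 2 + y ^ 2 + t * (1 - t) * q ^ 2

/-- The squared mass in the Feynman parametrization of the inner integral. -/
def feynmanMass (p q x y t : ℝ) : ℝ :=
  mixedSq q x y t ^ 2 + t * (1 - t) * (p ^ 2 + q ^ 2 * (2 * x + q) ^ 2)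

/-- The variance identity `(1-t)R² + tS² = ((1-t)R + tS)² + t(1-t)(S-R)²`, where `S - R = q(2x +
q)`. -/
theorem feynmanMass_eq (p q x y t : ℝ) : feynmanMass p q x y t =
    t * (1 - t) * p ^ 2 + (1 - t) * (x ^ 2 + y ^ 2) ^ 2 + t * ((x + q) ^ 2 + y ^ 2) ^ 2 := by
  unfold feynmanMass mixedSq
  ring

theorem sq_le_mixedSq (q x y : ℝ) {t : ℝ} (h0 : 0 < t) (h1 : t < 1) : y ^ 2 ≤ mixedSq q x y t := by
  have := mul_pos h0 (sub_pos.2 h1)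
  unfold mixedSq
  nlinarith [sq_nonneg (x + t * q), mul_nonneg this.le (sq_nonneg q)]

theorem mixedSq_sq_le (p q x y : ℝ) {t : ℝ} (h0 : 0 < t) (h1 : t < 1) :
    mixedSq q x y t ^ 2 ≤ feynmanMass p q x y t := by
  have := mul_pos h0 (sub_pos.2 h1)
  have : 0 ≤ t * (1 - t) * (p ^ 2 + q ^ 2 * (2 * x + q) ^ 2) := by positivity
  unfold feynmanMass
  linarith

theorem mixedSq_pos (q x : ℝ) {y t : ℝ} (hy : 0 < y) (h0 : 0 < t) (h1 : t < 1) :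
    0 < mixedSq q x y t := (pow_pos hy 2).trans_le (sq_le_mixedSq q x y h0 h1)

theorem feynmanMass_pos (p q x : ℝ) {y t : ℝ} (hy : 0 < y) (h0 : 0 < t) (h1 : t < 1) :
    0 < feynmanMass p q x y t :=
  (pow_pos (mixedSq_pos q x hy h0 h1) 2).trans_le (mixedSq_sq_le p q x y h0 h1)

theorem hasDerivAt_feynmanMass (p q x y t : ℝ) :
    HasDerivAt (fun y => feynmanMass p q x y t) (4 * y * mixedSq q x y t) y := by
  have h : HasDerivAt (fun y => mixedSq q x y t) (2 * y) y := by
    simpa [mixedSq] using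
      ((hasDerivAt_pow 2 y).const_add ((x + t * q) ^ 2)).add_const (t * (1 - t) * q ^ 2)
  refine ((h.pow 2).add_const (t * (1 - t) * (p ^ 2 + q ^ 2 * (2 * x + q) ^ 2))).congr_deriv ?_
  push_cast
  ring

theorem measurable_feynmanMass_rpow (p q x y r : ℝ) :
    Measurable fun t => feynmanMass p q x y t ^ r := by
  unfold feynmanMass mixedSq
  fun_prop

theorem mixedSq_le (q x y : ℝ) {t : ℝ} (h0 : 0 < t) (h1 : t < 1) :
    mixedSq q x y t ≤ x ^ 2 + (x + q) ^ 2 + y ^ 2 := by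
  have := sub_pos.2 h1
  unfold mixedSq
  nlinarith [mul_nonneg h0.le (sq_nonneg x), mul_nonneg this.le (sq_nonneg (x + q))]

/-- Differentiation under the integral: for `y/2 < z < 2y` the mass is at least `(y/2)⁴`, so a
constant dominates the derivative. -/
theorem hasDerivAt_integral_feynmanMass {a : ℝ} (ha : 0 < a) (p q x : ℝ) {y : ℝ} (hy : 0 < y) :
    HasDerivAt (fun y => ∫ t, feynmanMass p q x y t ^ (-a) ∂unitMeasure)
      (∫ t, -a * (4 * y) * (feynmanMass p q x y t ^ (-(a + 1)) * mixedSq q x y t) ∂unitMeasure)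
      y := by
  have hlow : ∀ t, 0 < t → t < 1 → ∀ z, y / 2 < z → (y / 2) ^ 4 ≤ feynmanMass p q x z t := by
    intro t h0 h1 z hz
    calc (y / 2) ^ 4 ≤ (z ^ 2) ^ 2 := by
          rw [← pow_mul]; exact pow_le_pow_left₀ (by positivity) hz.le 4
      _ ≤ mixedSq q x z t ^ 2 := pow_le_pow_left₀ (sq_nonneg z) (sq_le_mixedSq q x z h0 h1) 2
      _ ≤ _ := mixedSq_sq_le p q x z h0 h1
  have hc : 0 < (y / 2) ^ 4 := by positivity
  refine (hasDerivAt_integral_of_dominated_loc_of_deriv_le (s := Set.Ioo (y / 2) (2 * y))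
    (bound := fun _ => a * (4 * (2 * y)) * (((y / 2) ^ 4) ^ (-(a + 1)) *
      (x ^ 2 + (x + q) ^ 2 + (2 * y) ^ 2)))
    (F' := fun y t => -a * (4 * y) * (feynmanMass p q x y t ^ (-(a + 1)) * mixedSq q x y t))
    (Ioo_mem_nhds (by linarith) (by linarith))
    (Eventually.of_forall fun z => (measurable_feynmanMass_rpow ..).aestronglyMeasurable)
    ?_ ?_ ?_ (integrable_const _) ?_).2
  · refine Integrable.mono' (integrable_const (((y / 2) ^ 4) ^ (-a)))
      (measurable_feynmanMass_rpow ..).aestronglyMeasurable (ae_unitMeasure fun t h0 h1 => ?_)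
    have h := hlow t h0 h1 y (by linarith)
    rw [Real.norm_of_nonneg (Real.rpow_nonneg (hc.le.trans h) _)]
    exact Real.rpow_le_rpow_of_nonpos hc h (by linarith)
  · refine Measurable.aestronglyMeasurable ?_
    refine Measurable.const_mul ((measurable_feynmanMass_rpow ..).mul ?_) _
    unfold mixedSq
    fun_prop
  · refine ae_unitMeasure fun t h0 h1 z hz => ?_
    have hz0 : 0 < z := by linarith [hz.1]
    have hW := mixedSq_pos q x hz0 h0 h1
    have hM := feynmanMass_pos p q x hz0 h0 h1
    rw [neg_mul, neg_mul, norm_neg, Real.norm_of_nonneg (by positivity)]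
    have h1' := Real.rpow_le_rpow_of_nonpos hc (hlow t h0 h1 z hz.1)
      (show -(a + 1) ≤ 0 by linarith)
    have h2' : mixedSq q x z t ≤ x ^ 2 + (x + q) ^ 2 + (2 * y) ^ 2 :=
      (mixedSq_le q x z h0 h1).trans (by nlinarith [hz.2])
    have := hz.2.le
    gcongr
  · refine ae_unitMeasure fun t h0 h1 z hz => ?_
    have hz0 : 0 < z := by linarith [hz.1]
    refine ((hasDerivAt_feynmanMass p q x z t).rpow_const
      (Or.inl (feynmanMass_pos p q x hz0 h0 h1).ne')).congr_deriv ?_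
    rw [show -a - 1 = -(a + 1) by ring]
    ring

theorem deriv_innerIntegral {D : ℝ} (hD0 : 0 < D) (hD4 : D < 4) (p q x : ℝ) {y : ℝ} (hy : 0 < y) :
    deriv (fun y => innerIntegral D p (x ^ 2 + y ^ 2) ((x + q) ^ 2 + y ^ 2)) y =
      -(loopConst D * (4 * (2 - D / 2)) * y *
        ∫ t, feynmanMass p q x y t ^ (-(3 - D / 2)) * mixedSq q x y t ∂unitMeasure) := by
  have e : (fun y => innerIntegral D p (x ^ 2 + y ^ 2) ((x + q) ^ 2 + y ^ 2)) =ᶠ[𝓝 y]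
      fun y => loopConst D * ∫ t, feynmanMass p q x y t ^ (-(2 - D / 2)) ∂unitMeasure := by
    filter_upwards [lt_mem_nhds hy] with z hz
    rw [innerIntegral_eq_integral hD0 hD4 p (by positivity) (by positivity)]
    simp only [feynmanMass_eq]
  rw [e.deriv_eq, ((hasDerivAt_integral_feynmanMass (show 0 < 2 - D / 2 by linarith)
    p q x hy).const_mul (loopConst D)).deriv, integral_const_mul,
    show 2 - D / 2 + 1 = 3 - D / 2 by ring]
  ring

/-! ### Comparison of the Feynman mass with a square -/

/-- The mass term for which `(x + t q)² + y² + comparisonGap p q t` is comparable to the square root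
of `feynmanMass p q x y t`. -/
noncomputable def comparisonGap (p q t : ℝ) : ℝ :=
  t * (1 - t) * q ^ 2 + √(t * (1 - t)) * (p + q ^ 2)

theorem abs_rpow_neg_sub_rpow_neg_le {b c v w : ℝ} (hb : 0 < b) (hc : 0 < c) (hv : c ≤ v)
    (hw : c ≤ w) : |v ^ (-b) - w ^ (-b)| ≤ b * c ^ (-b - 1) * |v - w| := by
  refine Convex.norm_image_sub_le_of_norm_hasDerivWithin_le (s := Set.Ici c)
    (f := fun z : ℝ => z ^ (-b)) (f' := fun z => -b * z ^ (-b - 1)) (fun z hz => ?_)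
    (fun z hz => ?_) (convex_Ici c) hw hv
  · have hz : c ≤ z := hz
    exact (Real.hasDerivAt_rpow_const (Or.inl (hc.trans_le hz).ne')).hasDerivWithinAt
  · have hz : c ≤ z := hz
    rw [norm_mul, norm_neg, Real.norm_of_nonneg hb.le,
      Real.norm_of_nonneg (Real.rpow_nonneg (hc.le.trans hz) _)]
    have := Real.rpow_le_rpow_of_nonpos hc hz (show -b - 1 ≤ 0 by linarith)
    gcongr

/-- The three terms are at most `√M`, `√M` and `3√M`, whence `25 = (1 + 1 + 3)²`. -/
theorem sq_add_div_le {M W P Q : ℝ} (hW : W ^ 2 ≤ M) (hP : P ^ 2 ≤ M) (hQ : Q ^ 2 ≤ 8 * M)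
    (h0 : 0 ≤ W + P + Q) : (W + P + Q) ^ 2 / 25 ≤ M := by
  have hM : 0 ≤ M := (sq_nonneg W).trans hW
  have h1 : W ≤ √M := Real.le_sqrt_of_sq_le hW
  have h2 : P ≤ √M := Real.le_sqrt_of_sq_le hP
  have h3 : Q ≤ 3 * √M := by
    refine le_of_sq_le_sq ?_ (by positivity)
    rw [mul_pow, Real.sq_sqrt hM]
    linarith
  have h4 : (W + P + Q) ^ 2 ≤ (5 * √M) ^ 2 := pow_le_pow_left₀ h0 (by linarith) 2
  rw [mul_pow, Real.sq_sqrt hM] at h4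
  linarith

/-- The part `√(t(1-t)) q²` is controlled because `|k|²` and `|k+q|²` cannot both be small: their
sum is at least `q²/2`, and each of the weights `t`, `1 - t` is at least `t(1-t)`. -/
theorem comparison_sq_le (p q x y : ℝ) (hp : 0 ≤ p) {t : ℝ} (hy : 0 < y) (h0 : 0 < t)
    (h1 : t < 1) :
    (mixedSq q x y t + √(t * (1 - t)) * (p + q ^ 2)) ^ 2 / 25 ≤ feynmanMass p q x y t := by
  have hτ := mul_pos h0 (sub_pos.2 h1)
  have hr2 : √(t * (1 - t)) ^ 2 = t * (1 - t) := Real.sq_sqrt hτ.le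
  have hW := mixedSq_pos q x hy h0 h1
  have hRS : q ^ 2 / 2 ≤ (x ^ 2 + y ^ 2) + ((x + q) ^ 2 + y ^ 2) := by
    linarith [sq_nonneg (2 * x + q), sq_nonneg y]
  have h2 : q ^ 4 / 8 ≤ (x ^ 2 + y ^ 2) ^ 2 + ((x + q) ^ 2 + y ^ 2) ^ 2 := by
    have := pow_le_pow_left₀ (by positivity) hRS 2
    linarith [sq_nonneg ((x ^ 2 + y ^ 2) - ((x + q) ^ 2 + y ^ 2))]
  have h3 := mul_le_mul_of_nonneg_left h2 hτ.le
  have h4 : t * (1 - t) ≤ t := by nlinarith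
  have h5 : t * (1 - t) ≤ 1 - t := by nlinarith
  have h6 := mul_le_mul_of_nonneg_right h5 (sq_nonneg (x ^ 2 + y ^ 2))
  have h7 := mul_le_mul_of_nonneg_right h4 (sq_nonneg ((x + q) ^ 2 + y ^ 2))
  have h8 : 0 ≤ t * (1 - t) * p ^ 2 := by positivity
  rw [mul_add, ← add_assoc]
  refine sq_add_div_le (mixedSq_sq_le p q x y h0 h1) ?_ ?_ (by positivity)
  · have : 0 ≤ t * (1 - t) * (q ^ 2 * (2 * x + q) ^ 2) := by positivity
    rw [mul_pow, hr2, feynmanMass]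
    linarith [sq_nonneg (mixedSq q x y t)]
  · rw [mul_pow, hr2, feynmanMass_eq]
    linarith

/-- The terms of order `W²` cancel; what is left has a factor `r` and is at most linear in `u`,
because `r p`, `r q²` and `W` are all at most `u`. -/
theorem abs_sub_comparison_sq_le {M W X p q r u : ℝ} (hp : 0 ≤ p) (hr0 : 0 < r) (hr1 : r ≤ 1)
    (hW : 0 < W) (hX : X ^ 2 ≤ 8 * W + 2 * q ^ 2)
    (hM : M = W ^ 2 + r ^ 2 * (p ^ 2 + q ^ 2 * X ^ 2)) (hu : u = W + r * (p + q ^ 2)) :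
    |M - u ^ 2| ≤ (2 * (p + q ^ 2) + (p + 10 * q ^ 2)) * (r * u) := by
  have hrc : 0 ≤ r * (p + q ^ 2) := by positivity
  have hWu : W ≤ u := by linarith
  have hu0 : 0 < u := by linarith
  have b1 : 0 ≤ r * p := by positivity
  have b2 : 0 ≤ r * q ^ 2 := by positivity
  have hrp : r * p ≤ u := by rw [hu, mul_add]; linarith
  have hrq : r * q ^ 2 ≤ u := by rw [hu, mul_add]; linarith
  have e0 : M - u ^ 2 = r ^ 2 * (p ^ 2 + q ^ 2 * X ^ 2) - r * (p + q ^ 2) * (u + W) := by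
    rw [hM, hu]; ring
  have e1 : r ^ 2 * (p ^ 2 + q ^ 2 * X ^ 2) ≤ (p + 10 * q ^ 2) * (r * u) := by
    have a1 : r ^ 2 * p ^ 2 ≤ p * (r * u) := by
      have := mul_le_mul_of_nonneg_left hrp b1
      linarith
    have a2 : r ^ 2 * (q ^ 2 * X ^ 2) ≤ r ^ 2 * (q ^ 2 * (8 * W + 2 * q ^ 2)) := by gcongr
    have a3 : r ^ 2 * (q ^ 2 * W) ≤ q ^ 2 * (r * u) := by
      have : r ^ 2 ≤ r := by nlinarith
      calc r ^ 2 * (q ^ 2 * W) ≤ r * (q ^ 2 * u) := by gcongr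
        _ = _ := by ring
    have a4 : r ^ 2 * (q ^ 2 * q ^ 2) ≤ q ^ 2 * (r * u) := by
      have := mul_le_mul_of_nonneg_left hrq b2
      linarith
    linarith
  have e2 : r * (p + q ^ 2) * (u + W) ≤ 2 * (p + q ^ 2) * (r * u) := by
    have := mul_le_mul_of_nonneg_left hWu hrc
    linarith
  have e3 : 0 ≤ r ^ 2 * (p ^ 2 + q ^ 2 * X ^ 2) := by positivity
  have e4 : 0 ≤ r * (p + q ^ 2) * (u + W) := by positivity
  have e5 : 0 ≤ 2 * (p + q ^ 2) * (r * u) := by positivity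
  have e6 : 0 ≤ (p + 10 * q ^ 2) * (r * u) := by positivity
  rw [abs_le, e0, add_mul]
  constructor <;> linarith

/-- The mean value theorem on `[u²/25, ∞)` handles `M ^ (-b) - (u²) ^ (-b)`; the term with `c` comes
from replacing `W` by `u`. The error gains one power of `u`, which removes the pole. -/
theorem abs_rpow_mul_sub_rpow_le {b c r u K M W : ℝ} (hb : 0 < b) (hrc : 0 ≤ r * c) (hW : 0 < W)
    (hu : u = W + r * c) (huM : u ^ 2 / 25 ≤ M) (hd : |M - u ^ 2| ≤ K * (r * u)) :
    |M ^ (-b) * W - u ^ (-(2 * b - 1))| ≤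
      (b * 25 ^ (b + 1) * K + c) * (r * u ^ (-(2 * b))) := by
  have hWu : W ≤ u := by linarith
  have hu0 : 0 < u := by linarith
  have hpow : (u ^ 2) ^ (-b) = u ^ (-(2 * b)) := by
    rw [← Real.rpow_natCast u 2, ← Real.rpow_mul hu0.le]; congr 1; push_cast; ring
  have hmv := abs_rpow_neg_sub_rpow_neg_le hb (show 0 < u ^ 2 / 25 by positivity) huM
    (show u ^ 2 / 25 ≤ u ^ 2 by linarith [sq_nonneg u])
  have hpow2 : (u ^ 2 / 25) ^ (-b - 1) * (u * u) = 25 ^ (b + 1) * u ^ (-(2 * b)) := by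
    rw [show -b - 1 = -(b + 1) by ring, Real.div_rpow (by positivity) (by norm_num),
      Real.rpow_neg (by norm_num : (0 : ℝ) ≤ 25), ← hpow, show -(b + 1) = -b - 1 by ring,
      Real.rpow_sub_one (by positivity)]
    field_simp
  have hpow1 : u ^ (-(2 * b - 1)) = u ^ (-(2 * b)) * u := by
    rw [show -(2 * b - 1) = -(2 * b) + 1 by ring, Real.rpow_add_one hu0.ne']
  have h0' : 0 ≤ u ^ (-(2 * b)) := by positivity
  calc |M ^ (-b) * W - u ^ (-(2 * b - 1))|
      = |(M ^ (-b) - (u ^ 2) ^ (-b)) * W - u ^ (-(2 * b)) * (r * c)| := by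
        rw [hpow1, hpow]; congr 1; linear_combination (-u ^ (-(2 * b))) * hu
    _ ≤ |M ^ (-b) - (u ^ 2) ^ (-b)| * W + u ^ (-(2 * b)) * (r * c) := by
        refine (abs_sub _ _).trans ?_
        rw [abs_mul, abs_of_pos hW, abs_of_nonneg (mul_nonneg h0' hrc)]
    _ ≤ b * (u ^ 2 / 25) ^ (-b - 1) * (K * (r * u)) * u + u ^ (-(2 * b)) * (r * c) := by
        have h1 : |M ^ (-b) - (u ^ 2) ^ (-b)| ≤ b * (u ^ 2 / 25) ^ (-b - 1) * (K * (r * u)) :=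
          hmv.trans (by gcongr)
        have := mul_le_mul h1 hWu hW.le ((abs_nonneg _).trans h1)
        linarith
    _ = b * ((u ^ 2 / 25) ^ (-b - 1) * (u * u)) * K * r + u ^ (-(2 * b)) * (r * c) := by ring
    _ = _ := by rw [hpow2]; ring

theorem abs_feynmanMass_rpow_sub_le {p b : ℝ} (hp : 0 ≤ p) (q : ℝ) (hb : 0 < b) :
    ∃ C, ∀ x y t : ℝ, 0 < y → 0 < t → t < 1 →
      |feynmanMass p q x y t ^ (-b) * mixedSq q x y t -
          ((x + t * q) ^ 2 + y ^ 2 + comparisonGap p q t) ^ (-(2 * b - 1))| ≤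
        C * (√(t * (1 - t)) *
          ((x + t * q) ^ 2 + y ^ 2 + comparisonGap p q t) ^ (-(2 * b))) := by
  refine ⟨b * 25 ^ (b + 1) * (2 * (p + q ^ 2) + (p + 10 * q ^ 2)) + (p + q ^ 2),
    fun x y t hy h0 h1 => ?_⟩
  have hτ := mul_pos h0 (sub_pos.2 h1)
  have hr2 : √(t * (1 - t)) ^ 2 = t * (1 - t) := Real.sq_sqrt hτ.le
  have hr0 : 0 < √(t * (1 - t)) := Real.sqrt_pos.2 hτ
  have hr1 : √(t * (1 - t)) ≤ 1 := Real.sqrt_le_one.2 (by nlinarith)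
  have hW := mixedSq_pos q x hy h0 h1
  have hu : (x + t * q) ^ 2 + y ^ 2 + comparisonGap p q t =
      mixedSq q x y t + √(t * (1 - t)) * (p + q ^ 2) := by
    rw [mixedSq, comparisonGap]
    ring
  -- Write `2x + q = 2(x + tq) + (1 - 2t)q` and use `(a + b)² ≤ 2a² + 2b²`.
  have hX : (2 * x + q) ^ 2 ≤ 8 * mixedSq q x y t + 2 * q ^ 2 := by
    rw [mixedSq]
    linarith [sq_nonneg (2 * (x + t * q) - (1 - 2 * t) * q), sq_nonneg y,
      mul_nonneg hτ.le (sq_nonneg q), sq_nonneg (x + t * q), sq_nonneg (q * (1 - 2 * t))]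
  rw [hu]
  exact abs_rpow_mul_sub_rpow_le hb (by positivity) hW rfl
    (comparison_sq_le p q x y hp hy h0 h1)
    (abs_sub_comparison_sq_le hp hr0 hr1 hW hX (by rw [hr2]; rfl) rfl)

/-! ### The parameter integral of the gap for small exponent -/

/-- Bernoulli's inequality for `d ^ ε` and `(d⁻¹) ^ ε`; the lower bound also uses `a + a⁻¹ ≥ 2`. -/
theorem abs_rpow_neg_sub_one_le {ε d : ℝ} (h0 : 0 ≤ ε) (h1 : ε ≤ 1) (hd : 0 < d) :
    |d ^ (-ε) - 1| ≤ ε * (d + d⁻¹) := by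
  have e1 := rpow_one_add_le_one_add_mul_self (s := d - 1) (by linarith) h0 h1
  have hi : 0 < d⁻¹ := inv_pos.2 hd
  have e2 := rpow_one_add_le_one_add_mul_self (s := d⁻¹ - 1) (by linarith) h0 h1
  rw [add_sub_cancel] at e1 e2
  rw [Real.inv_rpow hd.le, ← Real.rpow_neg hd.le] at e2
  have hprod : d ^ ε * d ^ (-ε) = 1 := by rw [← Real.rpow_add hd]; simp
  have hpos : 0 < d ^ (-ε) := by positivity
  have a1 : 0 ≤ ε * d := by positivity
  have a2 : 0 ≤ ε * d⁻¹ := by positivity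
  rw [abs_le]
  constructor
  · nlinarith [sq_nonneg (d ^ (-ε) - 1)]
  · nlinarith

theorem integrable_inv_sqrt_mul_one_sub :
    Integrable (fun t : ℝ => (√(t * (1 - t)))⁻¹) unitMeasure := by
  -- The integrand is the nonnegative derivative of `arcsin (2t - 1)`, which is continuous up to the
  -- endpoints.
  have h := intervalIntegral.integrableOn_deriv_of_nonneg (a := 0) (b := 1)
    (g := fun t : ℝ => Real.arcsin (2 * t - 1)) (g' := fun t => (√(t * (1 - t)))⁻¹)
    (by fun_prop) (fun t ht => ?_) (fun t _ => by positivity)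
  · exact h.mono_set Set.Ioo_subset_Ioc_self
  · have h1 : HasDerivAt (fun t : ℝ => 2 * t - 1) 2 t := by
      simpa using ((hasDerivAt_id t).const_mul 2).sub_const 1
    refine ((Real.hasDerivAt_arcsin (by linarith [ht.1]) (by linarith [ht.2])).comp t
      h1).congr_deriv ?_
    rw [show 1 - (2 * t - 1) ^ 2 = 2 ^ 2 * (t * (1 - t)) by ring,
      Real.sqrt_mul (by norm_num), Real.sqrt_sq (by norm_num)]
    field_simp

section Gap

variable {p q : ℝ} (hpq : 0 < p + q ^ 2)

theorem sqrt_mul_le_comparisonGap {t : ℝ} (h0 : 0 < t) (h1 : t < 1) :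
    √(t * (1 - t)) * (p + q ^ 2) ≤ comparisonGap p q t := by
  have := mul_pos h0 (sub_pos.2 h1)
  have : 0 ≤ t * (1 - t) * q ^ 2 := by positivity
  unfold comparisonGap
  linarith

include hpq in
theorem comparisonGap_pos {t : ℝ} (h0 : 0 < t) (h1 : t < 1) : 0 < comparisonGap p q t := by
  have := Real.sqrt_pos.2 (mul_pos h0 (sub_pos.2 h1))
  exact (by positivity : 0 < √(t * (1 - t)) * (p + q ^ 2)).trans_le
    (sqrt_mul_le_comparisonGap h0 h1)

theorem measurable_comparisonGap (p q : ℝ) : Measurable (comparisonGap p q) := by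
  unfold comparisonGap
  fun_prop

include hpq

theorem integrable_comparisonGap_add_inv :
    Integrable (fun t => comparisonGap p q t + (comparisonGap p q t)⁻¹) unitMeasure := by
  have hm := measurable_comparisonGap p q
  refine Integrable.add ?_ ?_
  · refine Integrable.mono' (integrable_const (q ^ 2 + (p + q ^ 2))) hm.aestronglyMeasurable
      (ae_unitMeasure fun t h0 h1 => ?_)
    rw [Real.norm_of_nonneg (comparisonGap_pos hpq h0 h1).le, comparisonGap]
    have hτ : t * (1 - t) ≤ 1 := by nlinarith
    have h2 : √(t * (1 - t)) ≤ 1 := Real.sqrt_le_one.2 hτ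
    have h3 := mul_le_mul_of_nonneg_right h2 hpq.le
    have h4 := mul_le_mul_of_nonneg_right hτ (sq_nonneg q)
    linarith
  · refine Integrable.mono' (integrable_inv_sqrt_mul_one_sub.mul_const (p + q ^ 2)⁻¹)
      hm.inv.aestronglyMeasurable (ae_unitMeasure fun t h0 h1 => ?_)
    rw [Real.norm_of_nonneg (inv_nonneg.2 (comparisonGap_pos hpq h0 h1).le), ← mul_inv]
    have := Real.sqrt_pos.2 (mul_pos h0 (sub_pos.2 h1))
    exact inv_anti₀ (by positivity) (sqrt_mul_le_comparisonGap h0 h1)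

variable {ε : ℝ} (h0 : 0 ≤ ε) (h1 : ε ≤ 1)
include h0 h1

theorem integrable_comparisonGap_rpow_sub_one :
    Integrable (fun t => comparisonGap p q t ^ (-ε) - 1) unitMeasure :=
  Integrable.mono' ((integrable_comparisonGap_add_inv hpq).const_mul ε)
    (((measurable_comparisonGap p q).pow_const _).sub_const _).aestronglyMeasurable
    (ae_unitMeasure fun _ ht0 ht1 => abs_rpow_neg_sub_one_le h0 h1 (comparisonGap_pos hpq ht0 ht1))

theorem integrable_comparisonGap_rpow :
    Integrable (fun t => comparisonGap p q t ^ (-ε)) unitMeasure := by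
  refine ((integrable_comparisonGap_rpow_sub_one hpq h0 h1).add
    (integrable_const (1 : ℝ))).congr (Eventually.of_forall fun t => ?_)
  simp

theorem abs_integral_comparisonGap_rpow_sub_one_le :
    |(∫ t, comparisonGap p q t ^ (-ε) ∂unitMeasure) - 1| ≤
      ε * ∫ t, (comparisonGap p q t + (comparisonGap p q t)⁻¹) ∂unitMeasure := by
  have h := integral_sub (integrable_comparisonGap_rpow hpq h0 h1)
    (integrable_const (μ := unitMeasure) (1 : ℝ))
  have h2 : ∫ _, (1 : ℝ) ∂unitMeasure = 1 := by simp
  rw [h2] at h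
  rw [← h, ← integral_const_mul]
  exact norm_integral_le_of_norm_le (f := fun t => comparisonGap p q t ^ (-ε) - 1)
    ((integrable_comparisonGap_add_inv hpq).const_mul ε) (ae_unitMeasure fun _ ht0 ht1 =>
      abs_rpow_neg_sub_one_le h0 h1 (comparisonGap_pos hpq ht0 ht1))

omit h0 h1 in
theorem sqrt_mul_comparisonGap_rpow_le {t : ℝ} (ht0 : 0 < t) (ht1 : t < 1) :
    √(t * (1 - t)) * comparisonGap p q t ^ (-ε - 1) ≤
      (p + q ^ 2)⁻¹ * comparisonGap p q t ^ (-ε) := by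
  have hd := comparisonGap_pos hpq ht0 ht1
  rw [Real.rpow_sub_one hd.ne', inv_mul_eq_div, mul_div_assoc', div_le_div_iff₀ hd hpq]
  have := mul_le_mul_of_nonneg_right (sqrt_mul_le_comparisonGap (p := p) (q := q) ht0 ht1)
    (show 0 ≤ comparisonGap p q t ^ (-ε) by positivity)
  linarith

theorem integrable_sqrt_mul_comparisonGap_rpow :
    Integrable (fun t => √(t * (1 - t)) * comparisonGap p q t ^ (-ε - 1)) unitMeasure := by
  refine Integrable.mono' ((integrable_comparisonGap_rpow hpq h0 h1).const_mul (p + q ^ 2)⁻¹)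
    (Measurable.aestronglyMeasurable ?_) (ae_unitMeasure fun t ht0 ht1 => ?_)
  · exact Measurable.mul (by fun_prop) ((measurable_comparisonGap p q).pow_const _)
  · have := comparisonGap_pos hpq ht0 ht1
    rw [Real.norm_of_nonneg (by positivity)]
    exact sqrt_mul_comparisonGap_rpow_le hpq ht0 ht1

/-- The factor `√(t(1-t))` absorbs one inverse power of the gap, so the bound is uniform in `ε`. -/
theorem integral_sqrt_mul_comparisonGap_rpow_le :
    ∫ t, √(t * (1 - t)) * comparisonGap p q t ^ (-ε - 1) ∂unitMeasure ≤
      (p + q ^ 2)⁻¹ *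
        (1 + ∫ t, (comparisonGap p q t + (comparisonGap p q t)⁻¹) ∂unitMeasure) := by
  have hL : 0 ≤ ∫ t, (comparisonGap p q t + (comparisonGap p q t)⁻¹) ∂unitMeasure :=
    integral_nonneg_of_ae (ae_unitMeasure fun t ht0 ht1 => by
      have := comparisonGap_pos hpq ht0 ht1
      simp only [Pi.zero_apply]
      positivity)
  have h2 := (abs_le.1 (abs_integral_comparisonGap_rpow_sub_one_le hpq h0 h1)).2
  have h3 := mul_le_of_le_one_left hL h1
  calc _ ≤ ∫ t, (p + q ^ 2)⁻¹ * comparisonGap p q t ^ (-ε) ∂unitMeasure :=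
        integral_mono_ae (integrable_sqrt_mul_comparisonGap_rpow hpq h0 h1)
          ((integrable_comparisonGap_rpow hpq h0 h1).const_mul _)
          (ae_unitMeasure fun t ht0 ht1 => sqrt_mul_comparisonGap_rpow_le hpq ht0 ht1)
    _ ≤ _ := by
      rw [integral_const_mul]
      gcongr
      linarith

end Gap

/-! ### The outer integral -/

theorem feynmanIntegral_eq_integral {D : ℝ} (hD0 : 0 < D) (hD4 : D < 4) (m p q : ℝ) :
    feynmanIntegral D m p q = ((2 * Real.pi) ^ m)⁻¹ *
      (Real.pi ^ ((m - 1) / 2) / Real.Gamma ((m + 1) / 2)) * (loopConst D * (4 * (2 - D / 2))) *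
      ∫ z, ∫ t, z.2 ^ m * (feynmanMass p q z.1 z.2 t ^ (-(3 - D / 2)) * mixedSq q z.1 z.2 t)
        ∂unitMeasure ∂halfPlane := by
  have e : ∀ᵐ z ∂halfPlane, z.2 ^ (m - 1) *
      deriv (fun y => innerIntegral D p (z.1 ^ 2 + y ^ 2) ((z.1 + q) ^ 2 + y ^ 2)) z.2 =
      -(loopConst D * (4 * (2 - D / 2))) * ∫ t, z.2 ^ m *
        (feynmanMass p q z.1 z.2 t ^ (-(3 - D / 2)) * mixedSq q z.1 z.2 t) ∂unitMeasure := by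
    refine ae_halfPlane fun x y hy => ?_
    rw [deriv_innerIntegral hD0 hD4 p q x hy, integral_const_mul]
    have : y ^ m = y ^ (m - 1) * y := by rw [Real.rpow_sub_one hy.ne']; field_simp
    rw [this]
    ring
  rw [feynmanIntegral, dimIntegral, volume_restrict_univ_prod_Ioi, integral_congr_ae e,
    integral_const_mul]
  ring

/-- The comparison integrated over all variables. `C` depends on neither `m` nor `ε`, and
`radialConst m (6 - D)` stays bounded as `ε → 0`, unlike `radialConst m (5 - D)`. -/
theorem exists_abs_integral_sub_le {D p q : ℝ} (hD4 : D < 4) (hp : 0 ≤ p) (hpq : 0 < p + q ^ 2) :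
    ∃ C, ∀ m ε : ℝ, 0 < m → 0 < ε → ε ≤ 1 → m / 2 = 4 - D - ε →
      |(∫ z, ∫ t, z.2 ^ m * (feynmanMass p q z.1 z.2 t ^ (-(3 - D / 2)) * mixedSq q z.1 z.2 t)
        ∂unitMeasure ∂halfPlane) -
        radialConst m (5 - D) * ∫ t, comparisonGap p q t ^ (-ε) ∂unitMeasure| ≤
      C * radialConst m (6 - D) := by
  obtain ⟨C, hC⟩ := abs_feynmanMass_rpow_sub_le hp q (show 0 < 3 - D / 2 by linarith)
  simp only [show 2 * (3 - D / 2) = 6 - D by ring, show 6 - D - 1 = 5 - D by ring] at hC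
  set L := ∫ t, (comparisonGap p q t + (comparisonGap p q t)⁻¹) ∂unitMeasure with hL
  refine ⟨|C| * ((p + q ^ 2)⁻¹ * (1 + L)), fun m ε hm h0 h1 hmε => ?_⟩
  have hν : -1 < m := by linarith
  -- This convergence condition is exactly `ε > 0`.
  have hs5 : 1 + m / 2 < 5 - D := by linarith
  have hs6 : 1 + m / 2 < 6 - D := by linarith
  have x5 : 1 + m / 2 - (5 - D) = -ε := by linarith
  have x6 : 1 + m / 2 - (6 - D) = -ε - 1 := by linarith
  have hd := measurable_comparisonGap p q
  have hd0 : ∀ t, 0 < t → t < 1 → 0 < comparisonGap p q t := fun t => comparisonGap_pos hpq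
  have i5 : Integrable (fun t => 1 * comparisonGap p q t ^ (1 + m / 2 - (5 - D))) unitMeasure := by
    simpa only [x5, one_mul] using integrable_comparisonGap_rpow hpq h0.le h1
  have i6 : Integrable (fun t => √(t * (1 - t)) * comparisonGap p q t ^ (1 + m / 2 - (6 - D)))
      unitMeasure := by
    simpa only [x6] using integrable_sqrt_mul_comparisonGap_rpow hpq h0.le h1
  have I5 := integrable_radial_param (w := fun _ => 1) (h := fun t => t * q) hν hs5
    (by fun_prop) (fun t _ _ => by norm_num) (by fun_prop) hd hd0 i5
  have V5 := integral_radial_param (w := fun _ => 1) (h := fun t => t * q) hν hs5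
    (by fun_prop) (fun t _ _ => by norm_num) (by fun_prop) hd hd0 i5
  have I6 := integrable_radial_param (w := fun t => √(t * (1 - t))) (h := fun t => t * q) hν hs6
    (by fun_prop) (fun t _ _ => by positivity) (by fun_prop) hd hd0 i6
  have V6 := integral_radial_param (w := fun t => √(t * (1 - t))) (h := fun t => t * q) hν hs6
    (by fun_prop) (fun t _ _ => by positivity) (by fun_prop) hd hd0 i6
  simp only [x5, one_mul] at I5 V5
  simp only [x6] at V6
  have hae : ∀ᵐ a ∂(unitMeasure.prod halfPlane), 0 < a.1 ∧ a.1 < 1 ∧ 0 < a.2.2 := by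
    have a1 : ∀ᵐ a ∂(unitMeasure.prod halfPlane), 0 < a.1 ∧ a.1 < 1 :=
      Measure.quasiMeasurePreserving_fst.ae (p := fun t => 0 < t ∧ t < 1)
        (ae_unitMeasure fun t h0 h1 => ⟨h0, h1⟩)
    have a2 : ∀ᵐ a ∂(unitMeasure.prod halfPlane), 0 < a.2.2 :=
      Measure.quasiMeasurePreserving_snd.ae (p := fun z => 0 < z.2)
        (ae_halfPlane fun x y hy => hy)
    filter_upwards [a1, a2] with a h1 h2 using ⟨h1.1, h1.2, h2⟩
  set k := fun a : ℝ × (ℝ × ℝ) => a.2.2 ^ m *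
    (feynmanMass p q a.2.1 a.2.2 a.1 ^ (-(3 - D / 2)) * mixedSq q a.2.1 a.2.2 a.1) with hk
  have hkm : Measurable k := by
    simp only [hk]
    unfold feynmanMass mixedSq
    fun_prop
  have hb : ∀ᵐ a ∂(unitMeasure.prod halfPlane), ‖k a - a.2.2 ^ m *
      ((a.2.1 + a.1 * q) ^ 2 + a.2.2 ^ 2 + comparisonGap p q a.1) ^ (-(5 - D))‖ ≤
      |C| * (√(a.1 * (1 - a.1)) * (a.2.2 ^ m *
        ((a.2.1 + a.1 * q) ^ 2 + a.2.2 ^ 2 + comparisonGap p q a.1) ^ (-(6 - D)))) := by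
    filter_upwards [hae] with ⟨t, x, y⟩ ⟨t0, t1, hy⟩
    have h2 := hC x y t hy t0 t1
    have hy' : 0 ≤ y ^ m := Real.rpow_nonneg hy.le m
    have := hd0 t t0 t1
    have h3 : 0 ≤ √(t * (1 - t)) *
        ((x + t * q) ^ 2 + y ^ 2 + comparisonGap p q t) ^ (-(6 - D)) := by positivity
    have h4 := h2.trans (mul_le_mul_of_nonneg_right (le_abs_self C) h3)
    simp only [hk]
    rw [← mul_sub, norm_mul, Real.norm_of_nonneg hy', Real.norm_eq_abs]
    refine (mul_le_mul_of_nonneg_left h4 hy').trans_eq ?_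
    ring
  -- Integrability of the true integrand follows from that of the comparison term and of the error;
  -- it justifies Fubini below.
  have I0 : Integrable k (unitMeasure.prod halfPlane) := by
    have := (Integrable.mono' (I6.const_mul |C|)
      (hkm.aestronglyMeasurable.sub I5.aestronglyMeasurable) hb).add I5
    simpa using this
  have e : ∫ z, ∫ t, z.2 ^ m * (feynmanMass p q z.1 z.2 t ^ (-(3 - D / 2)) * mixedSq q z.1 z.2 t)
      ∂unitMeasure ∂halfPlane = ∫ a, k a ∂(unitMeasure.prod halfPlane) :=
    (integral_prod_symm k I0).symm
  rw [e, ← V5, ← integral_sub I0 I5]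
  refine (norm_integral_le_of_norm_le (I6.const_mul |C|) hb).trans ?_
  rw [integral_const_mul, V6]
  have r0 := radialConst_pos hν hs6
  have := integral_sqrt_mul_comparisonGap_rpow_le hpq h0.le h1
  calc _ ≤ |C| * (radialConst m (6 - D) * ((p + q ^ 2)⁻¹ * (1 + L))) := by gcongr
    _ = _ := by ring

/-! ### Constants and the pole -/

/-- Legendre's duplication formula at `2 - D/2`; the rest is powers of `2` and `π`. -/
theorem four_pi_rpow_mul_Gamma_div {D : ℝ} (hD4 : D < 4) :
    (4 * Real.pi) ^ (D - 4) * loopConst D / Real.Gamma (4 - D) =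
      8 * (16 * Real.pi) ^ ((D - 7) / 2) / Real.Gamma (5 / 2 - D / 2) := by
  have h := Real.Gamma_mul_Gamma_add_half (2 - D / 2)
  rw [show 2 - D / 2 + 1 / 2 = 5 / 2 - D / 2 by ring, show 2 * (2 - D / 2) = 4 - D by ring] at h
  have g1 := Real.Gamma_pos_of_pos (show 0 < 5 / 2 - D / 2 by linarith)
  have g2 := Real.Gamma_pos_of_pos (show 0 < 4 - D by linarith)
  have hπ := Real.pi_pos
  rw [div_eq_div_iff g2.ne' g1.ne', loopConst]
  have e1 : (4 * Real.pi) ^ (D - 4) * (4 * Real.pi) ^ (-(D / 2)) =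
      2 ^ (D - 8) * Real.pi ^ (D / 2 - 4) := by
    rw [← Real.rpow_add (by positivity), Real.mul_rpow (by norm_num) hπ.le,
      show (4 : ℝ) = 2 ^ (2 : ℝ) by norm_num, ← Real.rpow_mul (by norm_num)]
    norm_num
    congr 2 <;> ring
  have e2 : 8 * (16 * Real.pi) ^ ((D - 7) / 2) = 2 ^ (2 * D - 11) * Real.pi ^ ((D - 7) / 2) := by
    rw [Real.mul_rpow (by norm_num) hπ.le, show (16 : ℝ) = 2 ^ (4 : ℝ) by norm_num,
      ← Real.rpow_mul (by norm_num), show (8 : ℝ) = 2 ^ (3 : ℝ) by norm_num, ← mul_assoc,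
      ← Real.rpow_add (by norm_num)]
    congr 2
    ring
  have e3 : (2 : ℝ) ^ (D - 8) * 2 ^ (1 - (4 - D)) = 2 ^ (2 * D - 11) := by
    rw [← Real.rpow_add (by norm_num)]; congr 1; ring
  have e4 : Real.pi ^ (D / 2 - 4) * √Real.pi = Real.pi ^ ((D - 7) / 2) := by
    rw [Real.sqrt_eq_rpow, ← Real.rpow_add hπ]; congr 1; ring
  calc _ = ((4 * Real.pi) ^ (D - 4) * (4 * Real.pi) ^ (-(D / 2))) *
        (Real.Gamma (2 - D / 2) * Real.Gamma (5 / 2 - D / 2)) := by ring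
    _ = (2 ^ (D - 8) * 2 ^ (1 - (4 - D))) * (Real.pi ^ (D / 2 - 4) * √Real.pi) *
        Real.Gamma (4 - D) := by rw [e1, h]; ring
    _ = _ := by rw [e2, e3, e4]

/-- The factor `Γ((m+1)/2)` cancels. The surviving `Γ(s - 1 - m/2)` is `Γ(ε)` for `s = 5 - D` and
`Γ(ε + 1)` for `s = 6 - D`. -/
theorem outer_prefactor_mul_radialConst {m : ℝ} (hm : 0 < m) (s : ℝ) :
    ((2 * Real.pi) ^ m)⁻¹ * (Real.pi ^ ((m - 1) / 2) / Real.Gamma ((m + 1) / 2)) *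
      radialConst m s =
      (4 * Real.pi) ^ (-(m / 2)) * Real.Gamma (s - 1 - m / 2) / (2 * Real.Gamma s) := by
  have hG := Real.Gamma_pos_of_pos (show 0 < (m + 1) / 2 by linarith)
  have hπ := Real.pi_pos
  have hp1 : (4 * Real.pi) ^ (m / 2) = 2 ^ m * Real.pi ^ (m / 2) := by
    rw [Real.mul_rpow (by norm_num) hπ.le, show (4 : ℝ) = 2 ^ (2 : ℝ) by norm_num,
      ← Real.rpow_mul (by norm_num)]
    congr 2; ring
  have hp2 : (2 * Real.pi) ^ m = 2 ^ m * (Real.pi ^ (m / 2) * Real.pi ^ (m / 2)) := by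
    rw [Real.mul_rpow (by norm_num) hπ.le, ← Real.rpow_add hπ]
    congr 2; ring
  have hp3 : Real.pi ^ ((m - 1) / 2) * √Real.pi = Real.pi ^ (m / 2) := by
    rw [Real.sqrt_eq_rpow, ← Real.rpow_add hπ]
    congr 1; ring
  rw [radialConst, Real.rpow_neg (by positivity), hp1, hp2, ← hp3]
  field_simp

theorem exists_abs_feynmanIntegral_sub_le {D p q : ℝ} (hD0 : 0 < D) (hD4 : D < 4) (hp : 0 ≤ p)
    (hpq : 0 < p + q ^ 2) :
    ∃ C, ∀ ε : ℝ, 0 < ε → ε ≤ 1 → ε < 4 - D →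
      |feynmanIntegral D (8 - 2 * D - 2 * ε) p q -
        8 * (16 * Real.pi) ^ ((D - 7) / 2) / Real.Gamma (5 / 2 - D / 2) *
          ((4 * Real.pi) ^ ε * Real.Gamma (ε + 1) / ε)| ≤
      C * ((4 * Real.pi) ^ ε * Real.Gamma (ε + 1)) := by
  obtain ⟨C, hC⟩ := exists_abs_integral_sub_le hD4 hp hpq
  set L := ∫ t, (comparisonGap p q t + (comparisonGap p q t)⁻¹) ∂unitMeasure with hL
  set K := 8 * (16 * Real.pi) ^ ((D - 7) / 2) / Real.Gamma (5 / 2 - D / 2) with hK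
  have hπ := Real.pi_pos
  have hK0 : 0 < K := by
    have := Real.Gamma_pos_of_pos (show 0 < 5 / 2 - D / 2 by linarith)
    positivity
  refine ⟨K * L + C * (K / (5 - D)), fun ε h0 h1 hε => ?_⟩
  set m := 8 - 2 * D - 2 * ε with hm
  have hm0 : 0 < m := by linarith
  have hmε : m / 2 = 4 - D - ε := by rw [hm]; ring
  have hC := hC m ε hm0 h0 h1 hmε
  have hI := abs_integral_comparisonGap_rpow_sub_one_le (p := p) (q := q) hpq h0.le h1
  rw [feynmanIntegral_eq_integral hD0 hD4]
  set P := ((2 * Real.pi) ^ m)⁻¹ * (Real.pi ^ ((m - 1) / 2) / Real.Gamma ((m + 1) / 2)) *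
    (loopConst D * (4 * (2 - D / 2))) with hP
  set X := ∫ z, ∫ t, z.2 ^ m *
    (feynmanMass p q z.1 z.2 t ^ (-(3 - D / 2)) * mixedSq q z.1 z.2 t) ∂unitMeasure ∂halfPlane
  set I := ∫ t, comparisonGap p q t ^ (-ε) ∂unitMeasure
  have g4 := Real.Gamma_pos_of_pos (show 0 < 4 - D by linarith)
  have gD := Real.Gamma_pos_of_pos (show 0 < 2 - D / 2 by linarith)
  have gm := Real.Gamma_pos_of_pos (show 0 < (m + 1) / 2 by linarith)
  have gε := Real.Gamma_pos_of_pos h0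
  have hG5 : Real.Gamma (5 - D) = (4 - D) * Real.Gamma (4 - D) := by
    rw [← Real.Gamma_add_one (by linarith)]; congr 1; ring
  have hG6 : Real.Gamma (6 - D) = (5 - D) * Real.Gamma (5 - D) := by
    rw [← Real.Gamma_add_one (by linarith)]; congr 1; ring
  have d4 : 0 < 4 - D := by linarith
  have d5 : 0 < 5 - D := by linarith
  have hP0 : 0 ≤ P := by
    have : 0 < 2 - D / 2 := by linarith
    rw [hP, loopConst]
    positivity
  have hε4 : (4 * Real.pi) ^ (-(m / 2)) = (4 * Real.pi) ^ (D - 4) * (4 * Real.pi) ^ ε := by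
    rw [← Real.rpow_add (by positivity), hmε]; congr 1; ring
  have hKD : K = (4 * Real.pi) ^ (D - 4) * loopConst D / Real.Gamma (4 - D) :=
    (four_pi_rpow_mul_Gamma_div hD4).symm
  have hP5 : P * radialConst m (5 - D) = K * ((4 * Real.pi) ^ ε * Real.Gamma (ε + 1) / ε) := by
    rw [hP, mul_right_comm, outer_prefactor_mul_radialConst hm0, hε4, hKD,
      show 5 - D - 1 - m / 2 = ε by rw [hmε]; ring, hG5, Real.Gamma_add_one h0.ne']
    field_simp
    ring
  have hP6 : P * radialConst m (6 - D) =
      K / (5 - D) * ((4 * Real.pi) ^ ε * Real.Gamma (ε + 1)) := by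
    rw [hP, mul_right_comm, outer_prefactor_mul_radialConst hm0, hε4, hKD,
      show 6 - D - 1 - m / 2 = ε + 1 by rw [hmε]; ring, hG6, hG5]
    field_simp
    ring
  set g := (4 * Real.pi) ^ ε * Real.Gamma (ε + 1) with hg
  have hg0 : 0 < g := by
    rw [hg, Real.Gamma_add_one h0.ne']; positivity
  -- The first term is the comparison error; in the second, `I - 1 = O(ε)` cancels the pole.
  calc |P * X - K * (g / ε)|
      = |P * (X - radialConst m (5 - D) * I) + K * (g / ε) * (I - 1)| := by
        rw [← hP5]; congr 1; ring
    _ ≤ P * |X - radialConst m (5 - D) * I| + K * (g / ε) * |I - 1| := by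
        refine (abs_add_le _ _).trans_eq ?_
        rw [abs_mul P, abs_mul (K * (g / ε)), abs_of_nonneg hP0,
          abs_of_nonneg (show 0 ≤ K * (g / ε) by positivity)]
    _ ≤ P * (C * radialConst m (6 - D)) + K * (g / ε) * (ε * L) := by gcongr
    _ = C * (P * radialConst m (6 - D)) + K * g * L := by field_simp
    _ = _ := by rw [hP6]; ring

/-- This function is `1` at `0`, so differentiability makes its deviation from `1` of order `ε`, and
dividing by `ε` leaves a bounded term. -/
theorem differentiableAt_rpow_mul_Gamma_add_one :
    DifferentiableAt ℝ (fun ε : ℝ => (4 * Real.pi) ^ ε * Real.Gamma (ε + 1)) 0 := by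
  have hπ := Real.pi_pos
  refine DifferentiableAt.mul ?_ ?_
  · exact ((hasDerivAt_id (0 : ℝ)).const_rpow (by positivity)).differentiableAt
  · refine DifferentiableAt.comp (g := Real.Gamma) (f := fun ε : ℝ => ε + 1) 0 ?_ (by fun_prop)
    refine Real.differentiableAt_Gamma fun k hk => ?_
    have : (0 : ℝ) ≤ k := k.cast_nonneg
    linarith

theorem mainTheorem11 (D : ℝ) (hD0 : 0 < D) (hD4 : D < 4)
    (p q : ℝ) (hp : 0 ≤ p) (hq : 0 ≤ q) (hpq : 0 < p ∨ 0 < q) :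
    (fun ε' : ℝ => feynmanIntegral D (8 - 2 * D - 2 * ε') p q -
        8 * (16 * Real.pi) ^ ((D - 7) / 2) / (ε' * Real.Gamma (5 / 2 - D / 2)))
      =O[𝓝[>] 0] (fun _ : ℝ => (1 : ℝ)) := by
  -- The only use of nonzero external momentum: it keeps the gap positive, an infrared cutoff.
  have hc : 0 < p + q ^ 2 := by rcases hpq with h | h <;> positivity
  obtain ⟨C, hC⟩ := exists_abs_feynmanIntegral_sub_le hD0 hD4 hp hc
  obtain ⟨B, hB⟩ := differentiableAt_rpow_mul_Gamma_add_one.isBigO_sub.bound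
  have hB := nhdsWithin_le_nhds (s := Set.Ioi 0) hB
  set K := 8 * (16 * Real.pi) ^ ((D - 7) / 2) / Real.Gamma (5 / 2 - D / 2) with hK
  have hπ := Real.pi_pos
  have hK0 : 0 < K := by
    have := Real.Gamma_pos_of_pos (show 0 < 5 / 2 - D / 2 by linarith)
    positivity
  refine IsBigO.of_bound (|C| * (1 + |B|) + K * |B|) ?_
  filter_upwards [hB, self_mem_nhdsWithin, Ioo_mem_nhdsGT one_pos,
    Ioo_mem_nhdsGT (sub_pos.2 hD4)] with ε hb h0 h1 hε
  have h0 : 0 < ε := h0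
  have hC := hC ε h0 h1.2.le hε.2
  set g := (4 * Real.pi) ^ ε * Real.Gamma (ε + 1) with hg
  simp only [zero_add, Real.rpow_zero, Real.Gamma_one, mul_one, sub_zero, Real.norm_eq_abs,
    abs_of_pos h0] at hb
  have hb : |g - 1| ≤ |B| * ε := hb.trans (by gcongr; exact le_abs_self B)
  have hg0 : 0 < g := by
    have := Real.Gamma_pos_of_pos (show 0 < ε + 1 by linarith)
    positivity
  have hg1 : g ≤ 1 + |B| := by
    have := (abs_le.1 hb).2
    have := mul_le_of_le_one_right (abs_nonneg B) h1.2.le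
    linarith
  rw [norm_one, mul_one, Real.norm_eq_abs]
  set F := feynmanIntegral D (8 - 2 * D - 2 * ε) p q
  have e : 8 * (16 * Real.pi) ^ ((D - 7) / 2) / (ε * Real.Gamma (5 / 2 - D / 2)) = K / ε := by
    rw [hK, div_div, mul_comm ε]
  calc |F - 8 * (16 * Real.pi) ^ ((D - 7) / 2) / (ε * Real.Gamma (5 / 2 - D / 2))|
      = |(F - K * (g / ε)) + K / ε * (g - 1)| := by rw [e]; congr 1; ring
    _ ≤ |F - K * (g / ε)| + K / ε * |g - 1| := by
        refine (abs_add_le _ _).trans_eq ?_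
        rw [abs_mul, abs_of_pos (show 0 < K / ε by positivity)]
    _ ≤ |C| * (1 + |B|) + K / ε * (|B| * ε) := by
        have : C * g ≤ |C| * (1 + |B|) := by
          have := le_abs_self C
          gcongr
        gcongr
        exact hC.trans this
    _ = _ := by field_simp
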